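/- Let $G(s)$ be a scalar rational, strictly proper transfer function with real coefficients and no poles on the imaginary axis, and let $\sigma\in\mathbb R$, $\sigma\neq 0$. Let $\mathcal P_{\rm PD}(\sigma)$ be the closed disk $\{z\in\mathbb C: |z-\tfrac1{2\sigma}|\le \tfrac1{2\sigma}\}$ if $\sigma>0$, and the exterior region $\{z\in\mathbb C: |z-\tfrac1{2\sigma}|\ge \tfrac1{2|\sigma|}\}$ if $\sigma<0$. The Nyquist plot of $G$ is the curve $\omega\mapsto G(j\omega)$, traversed for $\omega$ increasing from $-\infty$ to $\infty$ and closed up at the limit point $0$. Suppose that: 1. the number of counter-clockwise revolutions of the Nyquist plot of $G$ around the point $1/\sigma$ equals the number of poles of $G$ in the open right half-plane, counted with multiplicity; 2. the Nyquist plot of $G$ is contained in $\mathcal P_{\rm PD}(\sigma)$; 3. the Nyquist plot of $G$ does not pass through the point $1/\sigma$. Then $G$ is output-feedback passive with index $\sigma$. That is, the transfer function $H(s)=(1-\sigma G(s))^{-1}G(s)$ is well-defined ($1-\sigma G$ is not identically zero, and $1-\sigma G(s)\neq0$ at every $s$ with $\Re s\ge 0$ that is a pole of neither $G$ nor $H$)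 and passive: $H$ is proper; all poles of $H$ lie in the closed left half-plane; $H(j\omega)+\overline{H(j\omega)}\ge 0$ for every real $\omega$ such that $j\omega$ is not a pole of $H$; and every purely imaginary pole $j\omega$ of $H$ is simple with $\lim_{s\to j\omega}(s-j\omega)H(s)$ real and nonnegative. -/

import Mathlib

noncomputable section

namespace OFPassivity

open Filter Topology

/-- A scalar transfer function with real coefficients is an element of `RatFunc ℝ`.
`value H s` is its value at `s ∈ ℂ`; it is meaningful when `s` is not a pole of `H`. -/
def value (H : RatFunc ℝ) (s : ℂ) : ℂ :=
  RatFunc.eval (algebraMap ℝ ℂ) s H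

/-- The denominator of `H` in lowest terms, as a complex polynomial. -/
def complexDenom (H : RatFunc ℝ) : Polynomial ℂ :=
  H.denom.map (algebraMap ℝ ℂ)

/-- The point `s` is a pole of `H`: a zero of the denominator in lowest terms. -/
def IsPole (H : RatFunc ℝ) (s : ℂ) : Prop :=
  (complexDenom H).IsRoot s

/-- The order of `s` as a pole of `H` (`0` when `s` is not a pole). -/
def poleOrder (H : RatFunc ℝ) (s : ℂ) : ℕ :=
  (complexDenom H).rootMultiplicity s

/-- The number of poles in the open right half-plane, counted with multiplicity. -/
def numUnstablePoles (H : RatFunc ℝ) : ℕ :=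
  ∑ s ∈ (complexDenom H).roots.toFinset with 0 < s.re, poleOrder H s

/-- Proper: the degree of the numerator is at most that of the denominator. -/
def IsProper (H : RatFunc ℝ) : Prop :=
  H.num.degree ≤ H.denom.degree

/-- Strictly proper: the degree of the numerator is less than that of the denominator
(the zero transfer function is included). -/
def IsStrictlyProper (H : RatFunc ℝ) : Prop :=
  H.num.degree < H.denom.degree

/-- The point `jω` of the imaginary axis. -/
def jw (ω : ℝ) : ℂ :=
  Complex.I * ω

/-- Passivity of a single-input single-output linear time-invariant system with transfer
function `H`. The transfer functions `C (sI - A)⁻¹ B + D` of finite-dimensional systems are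
exactly the proper rational functions. -/
structure IsPassive (H : RatFunc ℝ) : Prop where
  proper : IsProper H
  poles_re_nonpos : ∀ s : ℂ, IsPole H s → s.re ≤ 0
  positive_damping : ∀ ω : ℝ, ¬ IsPole H (jw ω) →
    0 ≤ (value H (jw ω) + (starRingEnd ℂ) (value H (jw ω))).re
  imaginary_poles : ∀ ω : ℝ, IsPole H (jw ω) → poleOrder H (jw ω) = 1 ∧
    ∃ r : ℝ, 0 ≤ r ∧
      Tendsto (fun s : ℂ => (s - jw ω) * value H s) (𝓝[≠] (jw ω)) (𝓝 (r : ℂ))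

/-- The output-feedback transformed system `H = (1 - G σ)⁻¹ G`. -/
def outputFeedback (G : RatFunc ℝ) (σ : ℝ) : RatFunc ℝ :=
  (1 - G * RatFunc.C σ)⁻¹ * G

/-- `G` is output-feedback passive with index `σ`: the system `H = (1 - G σ)⁻¹ G` is well-defined
and passive. Well-definedness is asked for as a rational function and at every point of the
closed right half-plane where `G` and `H` are finite. -/
structure IsOFPassive (G : RatFunc ℝ) (σ : ℝ) : Prop where
  invertible : 1 - G * RatFunc.C σ ≠ 0
  invertible_at : ∀ s : ℂ, 0 ≤ s.re → ¬ IsPole G s → ¬ IsPole (outputFeedback G σ) s →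
    1 - value G s * (σ : ℂ) ≠ 0
  passive : IsPassive (outputFeedback G σ)

/-- The frequency response `ω ↦ G(jω)`, which for increasing `ω` traverses the Nyquist plot. -/
def nyquistCurve (G : RatFunc ℝ) (ω : ℝ) : ℂ :=
  value G (jw ω)

/-- The Nyquist plot of `G` as a subset of the complex plane. (For a strictly proper `G` the curve
closes up at `0`, its limit for `ω → ±∞`; that limit point satisfies the conditions below
automatically and is not added.) -/
def nyquistPlot (G : RatFunc ℝ) : Set ℂ :=
  Set.range (nyquistCurve G)

/-- The curve `γ`, traversed for increasing parameter, makes `n` counter-clockwise revolutions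
around the point `p`, which it does not meet: a continuous choice `θ` of the argument of `γ - p`
increases by `2πn` in total. -/
def MakesRevolutions (γ : ℝ → ℂ) (p : ℂ) (n : ℤ) : Prop :=
  ∃ (θ : ℝ → ℝ) (a b : ℝ), Continuous θ ∧
    (∀ t : ℝ, γ t - p = (‖γ t - p‖ : ℂ) * Complex.exp ((θ t : ℂ) * Complex.I)) ∧
    Tendsto θ atBot (𝓝 a) ∧ Tendsto θ atTop (𝓝 b) ∧ b - a = 2 * Real.pi * (n : ℝ)

/-- The positive damping region: for `σ > 0` the closed disk with centre `1/(2σ)` and radius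
`1/(2σ)`; for `σ < 0` the complement of the closed disk with centre `1/(2σ)` and radius
`1/(2|σ|)`, together with its boundary circle; for `σ = 0` the closed right half-plane. -/
def pdRegion (σ : ℝ) : Set ℂ :=
  if 0 < σ then
    Metric.closedBall ((1 / (2 * σ) : ℝ) : ℂ) (1 / (2 * σ))
  else if σ < 0 then
    (Metric.closedBall ((1 / (2 * σ) : ℝ) : ℂ) (1 / (2 * |σ|)))ᶜ ∪
      Metric.sphere ((1 / (2 * σ) : ℝ) : ℂ) (1 / (2 * |σ|))
  else
    {z : ℂ | 0 ≤ z.re}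

end OFPassivity

end

open Filter Topology Polynomial

namespace OFPassivity

/-! Write `G = N/D` in lowest terms and `M = D - σN`. Then `1 - σG = M/D` and `H = N/M` up to
cancellation, so it suffices to keep the zeros of `M` out of the closed right half-plane. On the
axis, `G - 1/σ = -σ⁻¹ M/D` is never zero. A degree-`n` polynomial with no imaginary roots and `k`
roots in the open right half-plane turns by `π(n - 2k)` along the axis (`hasArgChange_polynomial`).
As `deg M = deg D`, the plot turns by `2π(P - Z)` around `1/σ`, with `P`, `Z` the right half-plane
root counts of `D`, `M`; the hypothesis makes this `2πP`, so `Z = 0`. Positivity is pointwise: `Re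
(z/(1 - σz)) ≥ 0` follows from `Re z ≥ σ|z|²`, which is what `pdRegion` says. -/

/-- A continuous choice of the argument of `f` has limits at `±∞` and increases by `δ` in total. -/
def HasArgChange (f : ℝ → ℂ) (δ : ℝ) : Prop :=
  ∃ (θ : ℝ → ℝ) (a b : ℝ), Continuous θ ∧
    (∀ t : ℝ, f t = (‖f t‖ : ℂ) * Complex.exp ((θ t : ℂ) * Complex.I)) ∧
    Tendsto θ atBot (𝓝 a) ∧ Tendsto θ atTop (𝓝 b) ∧ b - a = δ

theorem HasArgChange.const (c : ℂ) : HasArgChange (fun _ => c) 0 :=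
  ⟨fun _ => c.arg, c.arg, c.arg, continuous_const,
    fun _ => (Complex.norm_mul_exp_arg_mul_I c).symm, tendsto_const_nhds, tendsto_const_nhds,
    sub_self _⟩

theorem HasArgChange.mul {f g : ℝ → ℂ} {δ ε : ℝ} (hf : HasArgChange f δ)
    (hg : HasArgChange g ε) : HasArgChange (fun t => f t * g t) (δ + ε) := by
  obtain ⟨θ, a, b, hc, he, ha, hb, hd⟩ := hf
  obtain ⟨φ, a', b', hc', he', ha', hb', hd'⟩ := hg
  refine ⟨fun t => θ t + φ t, a + a', b + b', hc.add hc', fun t => ?_, ha.add ha', hb.add hb',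
    by rw [← hd, ← hd']; ring⟩
  beta_reduce
  conv_lhs => rw [he t, he' t]
  rw [norm_mul]
  push_cast
  rw [add_mul, Complex.exp_add]
  ring

theorem HasArgChange.inv {f : ℝ → ℂ} {δ : ℝ} (hf : HasArgChange f δ) :
    HasArgChange (fun t => (f t)⁻¹) (-δ) := by
  obtain ⟨θ, a, b, hc, he, ha, hb, hd⟩ := hf
  refine ⟨fun t => -θ t, -a, -b, hc.neg, fun t => ?_, ha.neg, hb.neg, by rw [← hd]; ring⟩
  beta_reduce
  conv_lhs => rw [he t]
  rw [norm_inv, mul_inv, ← Complex.exp_neg]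
  push_cast
  rw [neg_mul]

/-- Two continuous arguments of a nonvanishing curve differ by `2π` times a continuous
integer-valued function, hence by a constant, which cancels in the total increase. -/
theorem HasArgChange.unique {f : ℝ → ℂ} {δ ε : ℝ} (h0 : ∀ t, f t ≠ 0)
    (hf : HasArgChange f δ) (hg : HasArgChange f ε) : δ = ε := by
  obtain ⟨θ, a, b, hc, he, ha, hb, hd⟩ := hf
  obtain ⟨φ, a', b', hc', he', ha', hb', hd'⟩ := hg
  have hint : ∀ t, ∃ n : ℤ, (θ t - φ t) / (2 * Real.pi) = n := by
    intro t
    have h1 : Complex.exp ((θ t : ℂ) * Complex.I) = Complex.exp ((φ t : ℂ) * Complex.I) := by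
      have hn : (‖f t‖ : ℂ) ≠ 0 := by exact_mod_cast norm_ne_zero_iff.2 (h0 t)
      exact mul_left_cancel₀ hn ((he t).symm.trans (he' t))
    obtain ⟨n, hn⟩ := Complex.exp_eq_exp_iff_exists_int.1 h1
    refine ⟨n, ?_⟩
    have h2 : (θ t : ℂ) = (φ t + n * (2 * Real.pi) : ℂ) := by
      apply mul_right_cancel₀ Complex.I_ne_zero
      rw [hn]; ring
    have h3 : θ t = φ t + n * (2 * Real.pi) := by exact_mod_cast h2
    rw [h3]
    field_simp
    ring
  choose n hn using hint
  have hcont : Continuous n := by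
    have h : Continuous fun t => (n t : ℝ) := by
      simp_rw [← hn]
      exact (hc.sub hc').div_const _
    exact Int.isClosedEmbedding_coe_real.isInducing.continuous_iff.2 h
  have hconst : ∀ t, θ t - φ t = θ 0 - φ 0 := by
    intro t
    have h1 : n t = n 0 := PreconnectedSpace.constant inferInstance hcont
    have h2 : (θ t - φ t) / (2 * Real.pi) = (θ 0 - φ 0) / (2 * Real.pi) := by
      rw [hn, hn, h1]
    exact (div_left_inj' (by positivity)).1 h2
  have hbot : a - a' = θ 0 - φ 0 := tendsto_nhds_unique
    ((ha.sub ha').congr hconst) tendsto_const_nhds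
  have htop : b - b' = θ 0 - φ 0 := tendsto_nhds_unique
    ((hb.sub hb').congr hconst) tendsto_const_nhds
  linarith

/-! ### Argument change of polynomials along the imaginary axis -/

theorem eq_norm_mul_exp_arctan {x y : ℝ} (hx : 0 < x) :
    (x + y * Complex.I : ℂ) = (‖(x + y * Complex.I : ℂ)‖ : ℂ) *
      Complex.exp ((Real.arctan (y / x) : ℝ) * Complex.I) := by
  have harg : (x + y * Complex.I : ℂ).arg = Real.arctan (y / x) := by
    have hre : 0 < (x + y * Complex.I : ℂ).re := by simpa using hx
    rw [Complex.arg_of_re_nonneg hre.le, Real.arctan_eq_arcsin, Complex.norm_eq_sqrt_sq_add_sq]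
    congr 1
    simp only [Complex.add_re, Complex.add_im, Complex.ofReal_re, Complex.ofReal_im,
      Complex.mul_re, Complex.mul_im, Complex.I_re, Complex.I_im]
    have h : (x + (y * 0 - 0 * 1)) ^ 2 + (0 + (y * 1 + 0 * 0)) ^ 2
        = x ^ 2 * (1 + (y / x) ^ 2) := by
      field_simp
      ring
    rw [h, Real.sqrt_mul (sq_nonneg x), Real.sqrt_sq hx.le]
    field_simp
    ring
  rw [← harg, Complex.norm_mul_exp_arg_mul_I]

theorem hasArgChange_linear_of_pos {x c : ℝ} (hx : 0 < x) :
    HasArgChange (fun t : ℝ => (x + (t - c : ℝ) * Complex.I : ℂ)) Real.pi := by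
  refine ⟨fun t => Real.arctan ((t - c) / x), -(Real.pi / 2), Real.pi / 2,
    Real.continuous_arctan.comp (by fun_prop), fun t => eq_norm_mul_exp_arctan hx, ?_, ?_, by ring⟩
  · refine (Real.tendsto_arctan_atBot.mono_right nhdsWithin_le_nhds).comp ?_
    exact (tendsto_atBot_add_const_right _ _ tendsto_id).atBot_div_const hx
  · refine (Real.tendsto_arctan_atTop.mono_right nhdsWithin_le_nhds).comp ?_
    exact (tendsto_atTop_add_const_right _ _ tendsto_id).atTop_div_const hx

theorem hasArgChange_linear_of_neg {x c : ℝ} (hx : x < 0) :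
    HasArgChange (fun t : ℝ => (x + (t - c : ℝ) * Complex.I : ℂ)) (-Real.pi) := by
  obtain ⟨θ, a, b, hc, he, ha, hb, hd⟩ := hasArgChange_linear_of_pos (c := c) (neg_pos.2 hx)
  -- the reflection `w ↦ -conj w` sends the argument `θ` to `π - θ`
  refine ⟨fun t => Real.pi - θ t, Real.pi - a, Real.pi - b, by fun_prop, fun t => ?_,
    tendsto_const_nhds.sub ha, tendsto_const_nhds.sub hb, by rw [← hd]; ring⟩
  have hrefl : (x + (t - c : ℝ) * Complex.I : ℂ) =
      -(starRingEnd ℂ) ((-x : ℝ) + (t - c : ℝ) * Complex.I : ℂ) := by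
    simp only [map_add, map_mul, Complex.conj_ofReal, Complex.conj_I]
    push_cast
    ring
  beta_reduce at he ⊢
  rw [hrefl, norm_neg, RCLike.norm_conj]
  conv_lhs => rw [he t]
  rw [map_mul, Complex.conj_ofReal, ← Complex.exp_conj, map_mul, Complex.conj_ofReal,
    Complex.conj_I]
  have hexp : Complex.exp ((Real.pi - θ t : ℝ) * Complex.I) =
      -Complex.exp (θ t * -Complex.I) := by
    rw [Complex.ofReal_sub, sub_mul, sub_eq_add_neg, Complex.exp_add, Complex.exp_pi_mul_I,
      mul_neg, neg_one_mul]
  rw [hexp]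
  ring

/-- Seen from a point left of the axis, the axis sweeps angle `π`; from the right, `-π`. Writing the
sign with an indicator makes products add up to a root count. -/
theorem hasArgChange_jw_sub {z : ℂ} (hz : z.re ≠ 0) :
    HasArgChange (fun ω => jw ω - z) (Real.pi * (1 - 2 * if 0 < z.re then 1 else 0)) := by
  have h : (fun ω => jw ω - z) =
      fun t : ℝ => ((-z.re : ℝ) + (t - z.im : ℝ) * Complex.I : ℂ) := by
    funext t
    apply Complex.ext <;> simp [jw]
  rw [h]
  split_ifs with hpos
  · convert hasArgChange_linear_of_neg (neg_lt_zero.2 hpos) using 1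
    ring
  · convert hasArgChange_linear_of_pos (neg_pos.2 (lt_of_le_of_ne (not_lt.1 hpos) hz)) using 1
    ring

theorem hasArgChange_multiset_prod (s : Multiset ℂ) (hs : ∀ z ∈ s, z.re ≠ 0) :
    HasArgChange (fun ω => (s.map fun z => jw ω - z).prod)
      (Real.pi * (s.card - 2 * (s.filter fun z => 0 < z.re).card)) := by
  induction s using Multiset.induction_on with
  | empty => simpa using HasArgChange.const 1
  | cons z s ih =>
    have h := (hasArgChange_jw_sub (hs z (Multiset.mem_cons_self z s))).mul
      (ih fun w hw => hs w (Multiset.mem_cons_of_mem hw))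
    simp only [Multiset.map_cons, Multiset.prod_cons]
    convert h using 1
    by_cases hz : 0 < z.re
    · rw [Multiset.filter_cons_of_pos (p := fun z : ℂ => 0 < z.re) _ hz, if_pos hz]
      simp only [Multiset.card_cons]
      push_cast
      ring
    · rw [Multiset.filter_cons_of_neg (p := fun z : ℂ => 0 < z.re) _ hz, if_neg hz]
      simp only [Multiset.card_cons]
      push_cast
      ring

/-- The argument principle for a polynomial on the imaginary axis. -/
theorem hasArgChange_polynomial (P : ℂ[X]) (hP : ∀ ω, P.eval (jw ω) ≠ 0) :
    HasArgChange (fun ω => P.eval (jw ω))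
      (Real.pi * (P.natDegree - 2 * (P.roots.filter fun z => 0 < z.re).card)) := by
  have hroots : ∀ z ∈ P.roots, z.re ≠ 0 := by
    intro z hz hre
    refine hP z.im ?_
    have : jw z.im = z := by apply Complex.ext <;> simp [jw, hre]
    rw [this]
    exact (Polynomial.mem_roots'.1 hz).2
  have h := (HasArgChange.const P.leadingCoeff).mul (hasArgChange_multiset_prod _ hroots)
  have hsplit := IsAlgClosed.splits P
  rw [← hsplit.natDegree_eq_card_roots, zero_add] at h
  convert h using 2 with ω
  conv_lhs => rw [hsplit.eq_prod_roots]
  rw [Polynomial.eval_mul, Polynomial.eval_C, Polynomial.eval_multiset_prod, Multiset.map_map]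
  simp

theorem numUnstablePoles_eq_card (G : RatFunc ℝ) :
    numUnstablePoles G = ((complexDenom G).roots.filter fun z => 0 < z.re).card := by
  classical
  rw [numUnstablePoles, ← Multiset.toFinset_sum_count_eq, Multiset.toFinset_filter]
  refine Finset.sum_congr rfl fun z hz => ?_
  rw [poleOrder, Multiset.count_filter_of_pos (p := fun z : ℂ => 0 < z.re) (Finset.mem_filter.1 hz).2,
    Polynomial.count_roots]

/-! ### Algebra of the closed loop -/

/-- The denominator `den - σ num` of the closed loop. -/
noncomputable def closedLoopDenom (G : RatFunc ℝ) (σ : ℝ) : ℝ[X] :=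
  G.denom - C σ * G.num

theorem degree_C_mul_num_lt {G : RatFunc ℝ} (hG : IsStrictlyProper G) (σ : ℝ) :
    (C σ * G.num).degree < G.denom.degree :=
  by
  refine lt_of_le_of_lt ?_ hG
  rw [← Polynomial.smul_eq_C_mul]
  exact Polynomial.degree_smul_le σ _

theorem degree_closedLoopDenom {G : RatFunc ℝ} (hG : IsStrictlyProper G) (σ : ℝ) :
    (closedLoopDenom G σ).degree = G.denom.degree :=
  Polynomial.degree_sub_eq_left_of_degree_lt (degree_C_mul_num_lt hG σ)

theorem closedLoopDenom_ne_zero {G : RatFunc ℝ} (hG : IsStrictlyProper G) (σ : ℝ) :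
    closedLoopDenom G σ ≠ 0 := by
  rw [← Polynomial.degree_ne_bot, degree_closedLoopDenom hG, Polynomial.degree_ne_bot]
  exact G.denom_ne_zero

theorem one_sub_mul_C_eq (G : RatFunc ℝ) (σ : ℝ) :
    1 - G * RatFunc.C σ = algebraMap ℝ[X] (RatFunc ℝ) (closedLoopDenom G σ) /
      algebraMap ℝ[X] (RatFunc ℝ) G.denom := by
  have hd : algebraMap ℝ[X] (RatFunc ℝ) G.denom ≠ 0 := RatFunc.algebraMap_ne_zero G.denom_ne_zero
  rw [eq_div_iff hd, closedLoopDenom, map_sub, map_mul, RatFunc.algebraMap_C]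
  have hn : algebraMap ℝ[X] (RatFunc ℝ) G.num = G * algebraMap ℝ[X] (RatFunc ℝ) G.denom :=
    (div_eq_iff hd).1 (RatFunc.num_div_denom G)
  rw [hn]
  ring

theorem outputFeedback_eq_div {G : RatFunc ℝ} (hG : IsStrictlyProper G) (σ : ℝ) :
    outputFeedback G σ = algebraMap ℝ[X] (RatFunc ℝ) G.num /
      algebraMap ℝ[X] (RatFunc ℝ) (closedLoopDenom G σ) := by
  have hd : algebraMap ℝ[X] (RatFunc ℝ) G.denom ≠ 0 := RatFunc.algebraMap_ne_zero G.denom_ne_zero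
  have hM := RatFunc.algebraMap_ne_zero (closedLoopDenom_ne_zero hG σ)
  have hn : algebraMap ℝ[X] (RatFunc ℝ) G.num = G * algebraMap ℝ[X] (RatFunc ℝ) G.denom :=
    (div_eq_iff hd).1 (RatFunc.num_div_denom G)
  rw [outputFeedback, one_sub_mul_C_eq, hn]
  field_simp

/-- Avoids proving `G.num` and `closedLoopDenom G σ` coprime: the reduced fraction of the closed
loop is handled by cross-multiplication. -/
theorem outputFeedback_num_mul {G : RatFunc ℝ} (hG : IsStrictlyProper G) (σ : ℝ) :
    (outputFeedback G σ).num * closedLoopDenom G σ = G.num * (outputFeedback G σ).denom :=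
  (RatFunc.num_mul_eq_mul_denom_iff (closedLoopDenom_ne_zero hG σ)).2
    (outputFeedback_eq_div hG σ)

theorem outputFeedback_denom_dvd {G : RatFunc ℝ} (hG : IsStrictlyProper G) (σ : ℝ) :
    (outputFeedback G σ).denom ∣ closedLoopDenom G σ := by
  rw [outputFeedback_eq_div hG]
  exact RatFunc.denom_div_dvd _ _

theorem outputFeedback_isProper {G : RatFunc ℝ} (hG : IsStrictlyProper G) (σ : ℝ) :
    IsProper (outputFeedback G σ) := by
  have h := congrArg Polynomial.degree (outputFeedback_num_mul hG σ)
  rw [Polynomial.degree_mul, Polynomial.degree_mul, degree_closedLoopDenom hG] at h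
  have hle : (outputFeedback G σ).num.degree + G.denom.degree ≤
      (outputFeedback G σ).denom.degree + G.denom.degree := by
    rw [h, add_comm]
    gcongr
    exact le_of_lt hG
  exact WithBot.le_of_add_le_add_right (Polynomial.degree_ne_bot.2 G.denom_ne_zero) hle

theorem value_eq (G : RatFunc ℝ) (s : ℂ) : value G s = aeval s G.num / aeval s G.denom := rfl

theorem isPole_iff (G : RatFunc ℝ) (s : ℂ) : IsPole G s ↔ aeval s G.denom = 0 := by
  rw [IsPole, complexDenom, Polynomial.IsRoot, Polynomial.eval_map_algebraMap]

theorem aeval_closedLoopDenom {G : RatFunc ℝ} (σ : ℝ) {s : ℂ} (hs : ¬ IsPole G s) :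
    aeval s (closedLoopDenom G σ) = aeval s G.denom * (1 - value G s * σ) := by
  rw [isPole_iff] at hs
  rw [value_eq, closedLoopDenom, map_sub, map_mul, Polynomial.aeval_C]
  field_simp
  simp [mul_comm]

theorem aeval_closedLoopDenom_eq_zero_of_isPole {G : RatFunc ℝ} (hG : IsStrictlyProper G)
    {σ : ℝ} {s : ℂ} (hs : IsPole (outputFeedback G σ) s) :
    aeval s (closedLoopDenom G σ) = 0 := by
  rw [isPole_iff] at hs
  obtain ⟨q, hq⟩ := outputFeedback_denom_dvd hG σ
  rw [hq, map_mul, hs, zero_mul]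

theorem value_outputFeedback {G : RatFunc ℝ} (hG : IsStrictlyProper G) {σ : ℝ} {s : ℂ}
    (hs : ¬ IsPole G s) (hM : aeval s (closedLoopDenom G σ) ≠ 0) :
    value (outputFeedback G σ) s = value G s / (1 - value G s * σ) := by
  have hH : aeval s (outputFeedback G σ).denom ≠ 0 := fun h =>
    hM (aeval_closedLoopDenom_eq_zero_of_isPole hG ((isPole_iff _ _).2 h))
  have h := congrArg (aeval s) (outputFeedback_num_mul hG σ)
  have hd : aeval s G.denom ≠ 0 := fun h => hs ((isPole_iff _ _).2 h)
  have hF : 1 - value G s * σ ≠ 0 := by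
    intro h0
    rw [aeval_closedLoopDenom σ hs, h0, mul_zero] at hM
    exact hM rfl
  rw [map_mul, map_mul, aeval_closedLoopDenom σ hs] at h
  have hn : aeval s G.num = value G s * aeval s G.denom := by
    rw [value_eq, div_mul_cancel₀ _ hd]
  rw [hn] at h
  rw [value_eq (outputFeedback G σ), div_eq_div_iff hH hF]
  apply mul_right_cancel₀ hd
  linear_combination h

/-! ### Positivity on the region and the Nyquist criterion -/

theorem re_div_nonneg_of_mem_pdRegion {σ : ℝ} (hσ : σ ≠ 0) {z : ℂ} (hz : z ∈ pdRegion σ) :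
    0 ≤ (z / (1 - z * σ)).re := by
  have hdist : ‖z - ((1 / (2 * σ) : ℝ) : ℂ)‖ ^ 2 =
      z.re ^ 2 + z.im ^ 2 - z.re / σ + (1 / (2 * σ)) ^ 2 := by
    rw [Complex.sq_norm, Complex.normSq_apply]
    simp only [Complex.sub_re, Complex.sub_im, Complex.ofReal_re, Complex.ofReal_im]
    field_simp
    ring
  have key : 0 ≤ z.re - σ * (z.re ^ 2 + z.im ^ 2) := by
    have hid : z.re - σ * (z.re ^ 2 + z.im ^ 2) =
        -σ * (z.re ^ 2 + z.im ^ 2 - z.re / σ) := by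
      field_simp
      ring
    rw [hid]
    -- Completing the square, the exterior gives a nonnegative second factor and the disk a
    -- nonpositive one; the sign of `-σ` matches in each case.
    rcases lt_or_gt_of_ne hσ with hneg | hpos
    · rw [pdRegion, if_neg hneg.not_gt, if_pos hneg] at hz
      have hle : 1 / (2 * |σ|) ≤ ‖z - ((1 / (2 * σ) : ℝ) : ℂ)‖ := by
        rcases hz with hz | hz
        · rw [Set.mem_compl_iff, Metric.mem_closedBall, not_le, dist_eq_norm] at hz
          exact hz.le
        · rw [Metric.mem_sphere, dist_eq_norm] at hz
          exact hz.ge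
      have hsq := pow_le_pow_left₀ (by positivity) hle 2
      have habs : (1 / (2 * |σ|)) ^ 2 = (1 / (2 * σ)) ^ 2 := by
        rw [div_pow, div_pow, mul_pow, mul_pow, sq_abs]
      rw [hdist, habs] at hsq
      exact mul_nonneg (by linarith) (by linarith)
    · rw [pdRegion, if_pos hpos, Metric.mem_closedBall, dist_eq_norm] at hz
      have hsq := pow_le_pow_left₀ (norm_nonneg _) hz 2
      rw [hdist] at hsq
      exact mul_nonneg_of_nonpos_of_nonpos (by linarith) (by linarith)
  -- The boundary point `z = 1/σ` needs no exclusion, since division by zero gives `0`.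
  rw [Complex.div_re, ← add_div]
  refine div_nonneg ?_ (Complex.normSq_nonneg _)
  simp only [Complex.sub_re, Complex.sub_im, Complex.one_re, Complex.one_im, Complex.mul_re,
    Complex.mul_im, Complex.ofReal_re, Complex.ofReal_im]
  linarith

/-- The Nyquist criterion: the closed loop has no poles in the closed right half-plane. -/
theorem aeval_closedLoopDenom_ne_zero {G : RatFunc ℝ} {σ : ℝ} (hG : IsStrictlyProper G)
    (hpoles : ∀ ω : ℝ, ¬ IsPole G (jw ω)) (hσ : σ ≠ 0)
    (hrev : MakesRevolutions (nyquistCurve G) ((1 / σ : ℝ) : ℂ) (numUnstablePoles G : ℤ))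
    (havoid : ((1 / σ : ℝ) : ℂ) ∉ nyquistPlot G) {s : ℂ} (hs : 0 ≤ s.re) :
    aeval s (closedLoopDenom G σ) ≠ 0 := by
  have hσ' : (σ : ℂ) ≠ 0 := by exact_mod_cast hσ
  have hD : ∀ ω, aeval (jw ω) G.denom ≠ 0 := fun ω h => hpoles ω ((isPole_iff _ _).2 h)
  have hγ : ∀ ω, nyquistCurve G ω - ((1 / σ : ℝ) : ℂ) ≠ 0 := fun ω h =>
    havoid ⟨ω, sub_eq_zero.1 h⟩
  have hratio : ∀ ω, nyquistCurve G ω - ((1 / σ : ℝ) : ℂ) =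
      -(σ : ℂ)⁻¹ * (aeval (jw ω) (closedLoopDenom G σ) * (aeval (jw ω) G.denom)⁻¹) := by
    intro ω
    have := hD ω
    rw [aeval_closedLoopDenom σ (hpoles ω), nyquistCurve]
    push_cast
    field_simp
    ring
  have hM : ∀ ω, aeval (jw ω) (closedLoopDenom G σ) ≠ 0 := by
    intro ω h
    apply hγ ω
    rw [hratio, h, zero_mul, mul_zero]
  set M : ℂ[X] := (closedLoopDenom G σ).map (algebraMap ℝ ℂ) with hMdef
  have hMeval : ∀ z, M.eval z = aeval z (closedLoopDenom G σ) := fun z => by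
    rw [hMdef, Polynomial.eval_map_algebraMap]
  have hDeval : ∀ z, (complexDenom G).eval z = aeval z G.denom := fun z => by
    rw [complexDenom, Polynomial.eval_map_algebraMap]
  have hdeg : M.natDegree = (complexDenom G).natDegree := by
    rw [hMdef, complexDenom, Polynomial.natDegree_map, Polynomial.natDegree_map]
    exact Polynomial.natDegree_eq_of_degree_eq (degree_closedLoopDenom hG σ)
  have h1 := hasArgChange_polynomial M fun ω => by rw [hMeval]; exact hM ω
  have h2 := hasArgChange_polynomial (complexDenom G) fun ω => by rw [hDeval]; exact hD ω
  have h3 := (HasArgChange.const (-(σ : ℂ)⁻¹)).mul (h1.mul h2.inv)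
  simp only [hMeval, hDeval, ← hratio] at h3
  -- `hrev` unfolds to `HasArgChange` of the shifted curve with change `2πP`.
  have h4 := HasArgChange.unique hγ hrev h3
  rw [numUnstablePoles_eq_card, hdeg] at h4
  push_cast at h4
  have h5 : ((M.roots.filter fun z => 0 < z.re).card : ℝ) = 0 := by
    have hpi := Real.pi_ne_zero
    apply mul_left_cancel₀ (mul_ne_zero two_ne_zero hpi)
    linear_combination h4
  have h6 : M.roots.filter (fun z => 0 < z.re) = 0 := by
    rw [← Multiset.card_eq_zero]
    exact_mod_cast h5
  intro h0
  -- The root count sees only the open half-plane; the axis is covered by `hM`.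
  rcases hs.eq_or_lt with hre | hre
  · apply hM s.im
    have : jw s.im = s := by apply Complex.ext <;> simp [jw, ← hre]
    rw [this, h0]
  · have hmem : s ∈ M.roots.filter (fun z => 0 < z.re) := by
      rw [Multiset.mem_filter, Polynomial.mem_roots', Polynomial.IsRoot, hMeval]
      refine ⟨⟨?_, h0⟩, hre⟩
      exact (Polynomial.map_ne_zero_iff (algebraMap ℝ ℂ).injective).2
        (closedLoopDenom_ne_zero hG σ)
    rw [h6] at hmem
    exact Multiset.notMem_zero _ hmem

end OFPassivity

theorem theorem3 (G : RatFunc ℝ) (σ : ℝ)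
    (hG_proper : OFPassivity.IsStrictlyProper G)
    (hG_poles : ∀ ω : ℝ, ¬ OFPassivity.IsPole G (OFPassivity.jw ω))
    (hσ : σ ≠ 0)
    (h_encirclement : OFPassivity.MakesRevolutions (OFPassivity.nyquistCurve G)
      ((1 / σ : ℝ) : ℂ) (OFPassivity.numUnstablePoles G : ℤ))
    (h_region : OFPassivity.nyquistPlot G ⊆ OFPassivity.pdRegion σ)
    (h_avoid : ((1 / σ : ℝ) : ℂ) ∉ OFPassivity.nyquistPlot G) :
    OFPassivity.IsOFPassive G σ := by
  have hM : ∀ s : ℂ, 0 ≤ s.re → Polynomial.aeval s (OFPassivity.closedLoopDenom G σ) ≠ 0 :=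
    fun s hs => OFPassivity.aeval_closedLoopDenom_ne_zero hG_proper hG_poles hσ h_encirclement
      h_avoid hs
  have hjw : ∀ ω : ℝ, (OFPassivity.jw ω).re = 0 := fun ω => by simp [OFPassivity.jw]
  refine ⟨?_, fun s hs hG _ h0 => hM s hs ?_, ?_, fun s hs => ?_, fun ω _ => ?_, fun ω hω => ?_⟩
  · rw [OFPassivity.one_sub_mul_C_eq]
    exact div_ne_zero
      (RatFunc.algebraMap_ne_zero (OFPassivity.closedLoopDenom_ne_zero hG_proper σ))
      (RatFunc.algebraMap_ne_zero G.denom_ne_zero)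
  · rw [OFPassivity.aeval_closedLoopDenom σ hG, h0, mul_zero]
  · exact OFPassivity.outputFeedback_isProper hG_proper σ
  · by_contra! hre
    exact hM s hre.le (OFPassivity.aeval_closedLoopDenom_eq_zero_of_isPole hG_proper hs)
  · have h := OFPassivity.re_div_nonneg_of_mem_pdRegion hσ (h_region ⟨ω, rfl⟩)
    rw [OFPassivity.value_outputFeedback hG_proper (hG_poles ω) (hM _ (hjw ω).ge),
      Complex.add_re, Complex.conj_re]
    exact add_nonneg h h
  -- The residue condition is vacuous: the closed loop has no imaginary poles.
  · exact absurd (OFPassivity.aeval_closedLoopDenom_eq_zero_of_isPole hG_proper hω)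
      (hM _ (hjw ω).ge)
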